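/- \textbf{Definitions.} A circuit in negation normal form (NNF) over Boolean variables $x_1,\dots,x_n$ is a single-output Boolean circuit (a directed acyclic graph) whose input gates are labelled with variables $x_i$ or negated variables $\neg x_i$ and whose internal gates are fanin-2 AND- and OR-gates; its size is the number of its gates. It is a d-DNNF if for every AND-gate the two subcircuits rooted at its inputs share no variable, and for every OR-gate the sets of assignments accepted by the two subcircuits rooted at its inputs are disjoint. A matrix $H\in\mathbb{F}_2^{m\times n}$ is $s$-good if every submatrix consisting of at least $n/3$ of its columns has rank at least $s$. The linear code with parity check matrix $H$ is $\{x\in\mathbb{F}_2^n : Hx=0\}$, and the characteristic function of a code of length $n$ is the Boolean function on $\mathbb{F}_2^n$ that accepts exactly the code words. \textbf{Theorem.} For $n\in\mathbb{N}$ let $m=\lfloor n/100\rfloor$ and let $\mathcal{C}_n$ be the set of linear codes of length $n$ that have an $(m-1)$-good parity check matrix in $\mathbb{F}_2^{m\times n}$. Then there are constants $c>0$ and $n_0$ such that, for every $n\ge n_0$, the set $\mathcal{C}_n$ is non-empty, and for every code in $\mathcal{C}_n$, every d-DNNF that encodes its characteristic function exactly has size at least $2^{cn}$. -/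

import Mathlib

/-- The gates of a circuit in negation normal form over the variables `X`, for the gate in
position `k` of a topological order: an input gate labelled with a variable or with a negated
variable, or a fanin-2 AND / OR gate whose two inputs are gates in earlier positions. -/
inductive NNFGate (X : Type*) (k : ℕ) where
  | pos (x : X)
  | neg (x : X)
  | and (l r : Fin k)
  | or (l r : Fin k)

/-- A circuit in negation normal form over `X`: a directed acyclic graph of gates (gates may be
shared), listed in a topological order, with a single output gate. Its `size` is the number of
its gates, input gates included. -/
structure NNF (X : Type*) where
  size : ℕ
  gate : (i : Fin size) → NNFGate X i
  output : Fin size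

namespace NNF

variable {X : Type*}

/-- The gate of `D` that is an input of gate `i` and has position `j` before `i`. -/
def child (D : NNF X) (i : Fin D.size) (j : Fin i) : Fin D.size :=
  ⟨j, j.2.trans i.2⟩

/-- The value in `𝔽₂` computed at gate `i` under the assignment `a`. -/
def eval (D : NNF X) (a : X → ZMod 2) (i : Fin D.size) : ZMod 2 :=
  match D.gate i with
  | .pos x => a x
  | .neg x => 1 + a x
  | .and l r => eval D a (D.child i l) * eval D a (D.child i r)
  | .or l r =>
      eval D a (D.child i l) + eval D a (D.child i r)
        + eval D a (D.child i l) * eval D a (D.child i r)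
termination_by (i : ℕ)
decreasing_by all_goals simp [child]

/-- The variables that label (possibly negated) the input gates of the subcircuit rooted
at gate `i`. -/
def vars (D : NNF X) (i : Fin D.size) : Set X :=
  match D.gate i with
  | .pos x => {x}
  | .neg x => {x}
  | .and l r => vars D (D.child i l) ∪ vars D (D.child i r)
  | .or l r => vars D (D.child i l) ∪ vars D (D.child i r)
termination_by (i : ℕ)
decreasing_by all_goals simp [child]

/-- The two subcircuits below any AND gate share no input variable. -/
def IsDecomposable (D : NNF X) : Prop :=
  ∀ (i : Fin D.size) (l r : Fin i), D.gate i = .and l r →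
    Disjoint (D.vars (D.child i l)) (D.vars (D.child i r))

/-- The two subcircuits below any OR gate accept disjoint sets of assignments. -/
def IsDeterministic (D : NNF X) : Prop :=
  ∀ (i : Fin D.size) (l r : Fin i), D.gate i = .or l r →
    ∀ a : X → ZMod 2, ¬ (D.eval a (D.child i l) = 1 ∧ D.eval a (D.child i r) = 1)

/-- A d-DNNF is a decomposable and deterministic NNF. -/
def IsDDNNF (D : NNF X) : Prop :=
  D.IsDecomposable ∧ D.IsDeterministic

/-- The circuit `D` represents (encodes) the Boolean function `f`. -/
def Encodes (D : NNF X) (f : (X → ZMod 2) → ZMod 2) : Prop :=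
  ∀ a : X → ZMod 2, D.eval a D.output = f a

end NNF

/-- An `m × n` matrix over `𝔽₂` is `s`-good if every submatrix consisting of at least `n / 3`
of its columns has rank at least `s`. -/
def IsGoodMatrix {m n : ℕ} (H : Matrix (Fin m) (Fin n) (ZMod 2)) (s : ℤ) : Prop :=
  ∀ I : Finset (Fin n), (n : ℝ) / 3 ≤ (I.card : ℝ) →
    s ≤ ((H.submatrix id (fun j : I => (j : Fin n))).rank : ℤ)

/-- The linear code of length `n` with parity check matrix `H`: the vectors `x` with `H x = 0`. -/
def codeOfCheckMatrix {m n : ℕ} (H : Matrix (Fin m) (Fin n) (ZMod 2)) :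
    Submodule (ZMod 2) (Fin n → ZMod 2) :=
  LinearMap.ker H.mulVecLin

open Classical in
/-- The characteristic function of a linear code: it accepts exactly the code words. -/
noncomputable def charFun_linearCode {n : ℕ} (C : Submodule (ZMod 2) (Fin n → ZMod 2)) :
    (Fin n → ZMod 2) → ZMod 2 :=
  fun x => if x ∈ C then 1 else 0

/-- The linear codes of length `n` that have an `(m - 1)`-good parity check matrix with
`m = ⌊n / 100⌋` rows. -/
def goodCodes (n : ℕ) : Set (Submodule (ZMod 2) (Fin n → ZMod 2)) :=
  {C | ∃ H : Matrix (Fin (n / 100)) (Fin n) (ZMod 2),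
    IsGoodMatrix H (((n / 100 : ℕ) : ℤ) - 1) ∧ C = codeOfCheckMatrix H}

/-! Lower bound: the words accepted along paths through a gate `g` form a combinatorial rectangle
for the partition (variables of `g`, rest), by decomposability. Every code word passes through a
gate carrying between n/3 and 2n/3 of the variables (`exists_balanced_gate`). A rectangle of code
words over such a partition embeds, after a shift, in the product of the kernels of the two column
blocks of `H`; both have rank at least s, so it has at most 2^(n-2s) elements
(`ncard_mul_le_of_mix`). The code has at least 2^(n-m) words, so there are at least 2^(2s-m) gates,
which is 2^(m-2) for s = m-1. Existence of good matrices: random columns, an exponential moment and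
a union bound over pairs of row combinations (`exists_few_common_zeros`). -/

namespace NNF

variable {X : Type*} {D : NNF X}

/-! ### Rectangles and balanced gates in decomposable circuits -/

theorem eval_congr (a b : X → ZMod 2) (i : Fin D.size) (h : ∀ x ∈ D.vars i, a x = b x) :
    D.eval a i = D.eval b i := by
  induction i using WellFoundedLT.induction with
  | ind i ih =>
    rw [vars] at h
    rw [eval, eval]
    cases hg : D.gate i with
    | pos x => simp_all
    | neg x => simp_all
    | and l r =>
      simp only [hg, Set.mem_union] at h ⊢
      rw [ih (D.child i l) l.2 fun x hx => h x (Or.inl hx),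
        ih (D.child i r) r.2 fun x hx => h x (Or.inr hx)]
    | or l r =>
      simp only [hg, Set.mem_union] at h ⊢
      rw [ih (D.child i l) l.2 fun x hx => h x (Or.inl hx),
        ih (D.child i r) r.2 fun x hx => h x (Or.inr hx)]

theorem eval_and {i : Fin D.size} {l r : Fin i} (h : D.gate i = .and l r) (a : X → ZMod 2) :
    D.eval a i = D.eval a (D.child i l) * D.eval a (D.child i r) := by
  rw [eval, h]

theorem eval_or {i : Fin D.size} {l r : Fin i} (h : D.gate i = .or l r) (a : X → ZMod 2) :
    D.eval a i = D.eval a (D.child i l) + D.eval a (D.child i r)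
        + D.eval a (D.child i l) * D.eval a (D.child i r) := by
  rw [eval, h]

theorem eval_and_eq_one {i : Fin D.size} {l r : Fin i} (h : D.gate i = .and l r)
    (a : X → ZMod 2) :
    D.eval a i = 1 ↔ D.eval a (D.child i l) = 1 ∧ D.eval a (D.child i r) = 1 := by
  rw [eval_and h]
  generalize D.eval a (D.child i l) = u
  generalize D.eval a (D.child i r) = v
  revert u v
  decide

theorem eval_or_eq_one {i : Fin D.size} {l r : Fin i} (h : D.gate i = .or l r)
    (a : X → ZMod 2) :
    D.eval a i = 1 ↔ D.eval a (D.child i l) = 1 ∨ D.eval a (D.child i r) = 1 := by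
  rw [eval_or h]
  generalize D.eval a (D.child i l) = u
  generalize D.eval a (D.child i r) = v
  revert u v
  decide

theorem vars_and {i : Fin D.size} {l r : Fin i} (h : D.gate i = .and l r) :
    D.vars i = D.vars (D.child i l) ∪ D.vars (D.child i r) := by
  rw [vars, h]

theorem vars_or {i : Fin D.size} {l r : Fin i} (h : D.gate i = .or l r) :
    D.vars i = D.vars (D.child i l) ∪ D.vars (D.child i r) := by
  rw [vars, h]

/-- There is a path from the output to gate `i` on which every AND gate has its off-path input
satisfied by `a`. -/
inductive SatPath (D : NNF X) (a : X → ZMod 2) : Fin D.size → Prop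
  | output : SatPath D a D.output
  | and_left {i : Fin D.size} {l r : Fin i} (h : D.gate i = .and l r) (hi : SatPath D a i)
      (hr : D.eval a (D.child i r) = 1) : SatPath D a (D.child i l)
  | and_right {i : Fin D.size} {l r : Fin i} (h : D.gate i = .and l r) (hi : SatPath D a i)
      (hl : D.eval a (D.child i l) = 1) : SatPath D a (D.child i r)
  | or_left {i : Fin D.size} {l r : Fin i} (h : D.gate i = .or l r) (hi : SatPath D a i) :
      SatPath D a (D.child i l)
  | or_right {i : Fin D.size} {l r : Fin i} (h : D.gate i = .or l r) (hi : SatPath D a i) :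
      SatPath D a (D.child i r)

theorem SatPath.eval_output {a : X → ZMod 2} {i : Fin D.size} (h : SatPath D a i)
    (hi : D.eval a i = 1) : D.eval a D.output = 1 := by
  induction h with
  | output => exact hi
  | and_left h _ hr ih => exact ih ((eval_and_eq_one h a).2 ⟨hi, hr⟩)
  | and_right h _ hl ih => exact ih ((eval_and_eq_one h a).2 ⟨hl, hi⟩)
  | or_left h _ ih => exact ih ((eval_or_eq_one h a).2 (Or.inl hi))
  | or_right h _ ih => exact ih ((eval_or_eq_one h a).2 (Or.inr hi))

/-- By decomposability, the satisfied off-path inputs share no variable with the gate reached, so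
only values outside `D.vars i` matter. -/
theorem SatPath.congr (hD : D.IsDecomposable) {a b : X → ZMod 2} {i : Fin D.size}
    (h : SatPath D a i) (hab : ∀ x ∉ D.vars i, a x = b x) : SatPath D b i := by
  induction h with
  | output => exact .output
  | @and_left i l r h _ hr ih =>
    refine .and_left h (ih fun x hx => hab x fun hx' => hx ?_) ?_
    · rw [vars_and h]; exact Or.inl hx'
    · rw [← hr]
      exact (eval_congr a b _ fun x hx => hab x
        (Set.disjoint_right.1 (hD i l r h) hx)).symm
  | @and_right i l r h _ hl ih =>
    refine .and_right h (ih fun x hx => hab x fun hx' => hx ?_) ?_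
    · rw [vars_and h]; exact Or.inr hx'
    · rw [← hl]
      exact (eval_congr a b _ fun x hx => hab x
        (Set.disjoint_left.1 (hD i l r h) hx)).symm
  | @or_left i l r h _ ih =>
    refine .or_left h (ih fun x hx => hab x fun hx' => hx ?_)
    rw [vars_or h]; exact Or.inl hx'
  | @or_right i l r h _ ih =>
    refine .or_right h (ih fun x hx => hab x fun hx' => hx ?_)
    rw [vars_or h]; exact Or.inr hx'

/-- The assignments accepted along a path through gate `i`. -/
def acceptedThrough (D : NNF X) (i : Fin D.size) : Set (X → ZMod 2) :=
  {a | SatPath D a i ∧ D.eval a i = 1}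

theorem mem_acceptedThrough_of_mix (hD : D.IsDecomposable) {i : Fin D.size}
    {a b c : X → ZMod 2} (ha : a ∈ D.acceptedThrough i) (hb : b ∈ D.acceptedThrough i)
    (hac : ∀ x ∈ D.vars i, a x = c x) (hbc : ∀ x ∉ D.vars i, b x = c x) :
    c ∈ D.acceptedThrough i :=
  ⟨hb.1.congr hD hbc, (eval_congr a c i hac).symm.trans ha.2⟩

/-- Descend through satisfied gates: at AND the larger input keeps at least half of the variables.
At OR, the variables lost are free for `a`, so `hfree` forbids losing a third of them. -/
theorem exists_balanced_gate [Fintype X] (hD : D.IsDecomposable) {a : X → ZMod 2}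
    (hX : 2 ≤ Fintype.card X) (ha : D.eval a D.output = 1)
    (hfree : ∀ T : Set X, (∀ b : X → ZMod 2, (∀ x ∉ T, a x = b x) → D.eval b D.output = 1) →
      3 * T.ncard < Fintype.card X) :
    ∃ i, a ∈ D.acceptedThrough i ∧ Fintype.card X ≤ 3 * (D.vars i).ncard ∧
      3 * (D.vars i).ncard ≤ 2 * Fintype.card X := by
  have drop : ∀ i j, a ∈ D.acceptedThrough i → D.eval a j = 1 → D.vars j ⊆ D.vars i →
      (∀ b : X → ZMod 2, D.eval b j = 1 → D.eval b i = 1) →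
      2 * Fintype.card X < 3 * (D.vars i).ncard → Fintype.card X ≤ 3 * (D.vars j).ncard := by
    intro i j hi hj hsub himp hcard
    by_contra hlt
    have := hfree (D.vars i \ D.vars j) fun b hb => by
      refine SatPath.eval_output (hi.1.congr hD fun x hx => hb x fun h => hx h.1) (himp b ?_)
      rw [← hj]
      exact (eval_congr a b j fun x hx => hb x fun h => h.2 hx).symm
    have := Set.ncard_sdiff_add_ncard_of_subset hsub (Set.toFinite _)
    omega
  have descend : ∀ i, a ∈ D.acceptedThrough i → Fintype.card X ≤ 3 * (D.vars i).ncard →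
      ∃ i, a ∈ D.acceptedThrough i ∧ Fintype.card X ≤ 3 * (D.vars i).ncard ∧
        3 * (D.vars i).ncard ≤ 2 * Fintype.card X := by
    intro i
    induction i using WellFoundedLT.induction with
    | ind i ih =>
      intro hi hcard
      by_cases hle : 3 * (D.vars i).ncard ≤ 2 * Fintype.card X
      · exact ⟨i, hi, hcard, hle⟩
      cases hg : D.gate i with
      | pos x =>
        rw [vars, hg] at hle
        simp only [Set.ncard_singleton] at hle
        omega
      | neg x =>
        rw [vars, hg] at hle
        simp only [Set.ncard_singleton] at hle
        omega
      | and l r =>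
        have h1 := (eval_and_eq_one hg a).1 hi.2
        have h2 := Set.ncard_union_le (D.vars (D.child i l)) (D.vars (D.child i r))
        rw [← vars_and hg] at h2
        by_cases hl : Fintype.card X ≤ 3 * (D.vars (D.child i l)).ncard
        · exact ih _ l.2 ⟨.and_left hg hi.1 h1.2, h1.1⟩ hl
        · exact ih _ r.2 ⟨.and_right hg hi.1 h1.1, h1.2⟩ (by omega)
      | or l r =>
        have hv := vars_or hg
        rcases (eval_or_eq_one hg a).1 hi.2 with h | h
        · exact ih _ l.2 ⟨.or_left hg hi.1, h⟩ (drop i _ hi h (hv ▸ Set.subset_union_left)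
            (fun b hb => (eval_or_eq_one hg b).2 (Or.inl hb)) (by omega))
        · exact ih _ r.2 ⟨.or_right hg hi.1, h⟩ (drop i _ hi h (hv ▸ Set.subset_union_right)
            (fun b hb => (eval_or_eq_one hg b).2 (Or.inr hb)) (by omega))
  refine descend D.output ⟨.output, ha⟩ ?_
  by_contra hlt
  -- Variables that the output does not see are free too.
  have h1 := hfree (D.vars D.output)ᶜ fun b hb => by
    rw [← ha]
    exact (eval_congr a b _ fun x hx => hb x fun h => h hx).symm
  have h2 := Set.ncard_add_ncard_compl (D.vars D.output)
  rw [Nat.card_eq_fintype_card] at h2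
  omega

end NNF

/-! ### Codes with good parity check matrices -/

theorem natCard_ker_mulVecLin {α β : Type*} [Fintype α] [Fintype β]
    (M : Matrix α β (ZMod 2)) :
    Nat.card (LinearMap.ker M.mulVecLin) * 2 ^ M.rank = 2 ^ Fintype.card β := by
  have h := LinearMap.finrank_range_add_finrank_ker M.mulVecLin
  rw [Module.finrank_fintype_fun_eq_card] at h
  rw [Module.natCard_eq_pow_finrank (K := ZMod 2), Nat.card_zmod, ← pow_add, ← h, Matrix.rank,
    add_comm]

theorem mulVec_extend_subtype {m n : ℕ} (H : Matrix (Fin m) (Fin n) (ZMod 2))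
    (I : Finset (Fin n)) (x : Fin n → ZMod 2) (hx : ∀ j ∉ I, x j = 0) :
    (H.submatrix id (fun j : I => (j : Fin n))).mulVec (fun j : I => x j) = H.mulVec x := by
  ext i
  simp only [Matrix.mulVec, dotProduct, Matrix.submatrix_apply, id]
  rw [Finset.sum_coe_sort I (fun j => H i j * x j)]
  exact Finset.sum_subset (Finset.subset_univ I) fun j _ hj => by simp [hx j hj]

namespace IsGoodMatrix

variable {m n : ℕ} {H : Matrix (Fin m) (Fin n) (ZMod 2)} {s : ℕ}

theorem le_rank (hH : IsGoodMatrix H s) {I : Finset (Fin n)} (hI : n ≤ 3 * I.card) :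
    s ≤ (H.submatrix id (fun j : I => (j : Fin n))).rank := by
  have : (n : ℝ) ≤ 3 * I.card := by exact_mod_cast hI
  exact_mod_cast hH I (by linarith)

theorem natCard_ker_submatrix_mul_le (hH : IsGoodMatrix H s) {I : Finset (Fin n)}
    (hI : n ≤ 3 * I.card) :
    Nat.card (LinearMap.ker (H.submatrix id (fun j : I => (j : Fin n))).mulVecLin) * 2 ^ s
      ≤ 2 ^ I.card := by
  have h := natCard_ker_mulVecLin (H.submatrix id (fun j : I => (j : Fin n)))
  rw [Fintype.card_coe] at h
  rw [← h]
  exact Nat.mul_le_mul_left _ (Nat.pow_le_pow_right (by norm_num) (hH.le_rank hI))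

/-- A set of code words that is closed under mixing coordinates along a balanced partition
`(I, Iᶜ)` is small. -/
theorem ncard_mul_le_of_mix (hH : IsGoodMatrix H s) {I : Finset (Fin n)}
    (hI : n ≤ 3 * I.card) (hI' : 3 * I.card ≤ 2 * n) {A : Set (Fin n → ZMod 2)}
    (hA : ∀ a ∈ A, H.mulVec a = 0)
    (hmix : ∀ a ∈ A, ∀ b ∈ A, ∀ c : Fin n → ZMod 2, (∀ j ∈ I, a j = c j) →
      (∀ j ∉ I, b j = c j) → c ∈ A) :
    A.ncard * 2 ^ (2 * s) ≤ 2 ^ n := by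
  classical
  rcases A.eq_empty_or_nonempty with rfl | ⟨b, hb⟩
  · simp
  -- Mixing `a` on `J` with `b` elsewhere gives a code word whose difference from `b` is supported
  -- on `J`.
  have key : ∀ (J : Finset (Fin n)), (J = I ∨ J = Iᶜ) → ∀ a ∈ A,
      (H.submatrix id (fun j : J => (j : Fin n))).mulVec (fun j : J => a j - b j) = 0 := by
    intro J hJ a ha
    have h := mulVec_extend_subtype H J (fun j => (if j ∈ J then a j else b j) - b j)
      (fun j hj => by simp [hj])
    simp only [Finset.coe_mem, if_true] at h
    rw [h]
    have hc : (fun j => if j ∈ J then a j else b j) ∈ A := by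
      rcases hJ with rfl | rfl
      · exact hmix a ha b hb _ (fun j hj => by simp [hj]) (fun j hj => by simp [hj])
      · exact hmix b hb a ha _ (fun j hj => by simp [hj]) (fun j hj => by simp [hj])
    have := Matrix.mulVec_sub H (fun j => if j ∈ J then a j else b j) b
    rw [hA _ hc, hA _ hb, sub_zero] at this
    exact this
  let K := fun J : Finset (Fin n) =>
    LinearMap.ker (H.submatrix id (fun j : J => (j : Fin n))).mulVecLin
  let φ : A → K I × K Iᶜ := fun a =>
    (⟨fun j => a.1 j - b j, key I (Or.inl rfl) a.1 a.2⟩,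
      ⟨fun j => a.1 j - b j, key Iᶜ (Or.inr rfl) a.1 a.2⟩)
  have hφ : Function.Injective φ := by
    intro a a' h
    have h1 := congrArg Subtype.val (Prod.ext_iff.1 h).1
    have h2 := congrArg Subtype.val (Prod.ext_iff.1 h).2
    refine Subtype.ext (funext fun j => ?_)
    by_cases hj : j ∈ I
    · exact sub_left_injective (congrFun h1 ⟨j, hj⟩)
    · exact sub_left_injective (congrFun h2 ⟨j, Finset.mem_compl.2 hj⟩)
  have hcard : A.ncard ≤ Nat.card (K I) * Nat.card (K Iᶜ) := by
    rw [← Nat.card_coe_set_eq, ← Nat.card_prod]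
    exact Nat.card_le_card_of_injective φ hφ
  have hcompl : I.card + Iᶜ.card = n := by
    rw [Finset.card_add_card_compl, Fintype.card_fin]
  calc A.ncard * 2 ^ (2 * s) ≤ (Nat.card (K I) * Nat.card (K Iᶜ)) * 2 ^ (2 * s) :=
        Nat.mul_le_mul_right _ hcard
    _ = (Nat.card (K I) * 2 ^ s) * (Nat.card (K Iᶜ) * 2 ^ s) := by ring
    _ ≤ 2 ^ I.card * 2 ^ Iᶜ.card :=
        Nat.mul_le_mul (hH.natCard_ker_submatrix_mul_le hI)
          (hH.natCard_ker_submatrix_mul_le (by omega))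
    _ = 2 ^ n := by rw [← pow_add, hcompl]

/-- If `j` is free, `a` and `a + Pi.single j 1` are both code words, so column `j` vanishes; n/3
zero columns would have rank 0. -/
theorem ncard_lt_of_free (hH : IsGoodMatrix H s) (hs : 0 < s) {a : Fin n → ZMod 2}
    {T : Set (Fin n)}
    (hT : ∀ b : Fin n → ZMod 2, (∀ j ∉ T, a j = b j) → H.mulVec b = 0) :
    3 * T.ncard < n := by
  classical
  by_contra! hn
  rw [Set.ncard_eq_toFinset_card'] at hn
  have hr := hH.le_rank hn
  have h0 : H.submatrix id (fun j : T.toFinset => (j : Fin n)) = 0 := by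
    ext i ⟨j, hj⟩
    have hjT : j ∈ T := by simpa using hj
    have h1 := hT a fun _ _ => rfl
    have h2 := hT (a + Pi.single j 1) fun k hk => by
      have : k ≠ j := fun h => hk (h ▸ hjT)
      simp [this]
    rw [Matrix.mulVec_add, h1, zero_add] at h2
    simpa using congrFun h2 i
  rw [h0, Matrix.rank_zero] at hr
  omega

theorem two_pow_le_size (hH : IsGoodMatrix H s) (hs : 0 < s) (hn : 2 ≤ n) {D : NNF (Fin n)}
    (hD : D.IsDecomposable) (hDH : D.Encodes (charFun_linearCode (codeOfCheckMatrix H))) :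
    2 ^ (2 * s) ≤ D.size * 2 ^ m := by
  classical
  have hout : ∀ a, D.eval a D.output = 1 ↔ H.mulVec a = 0 := by
    intro a
    rw [hDH a, charFun_linearCode]
    change _ ↔ a ∈ codeOfCheckMatrix H
    by_cases h : a ∈ codeOfCheckMatrix H <;> simp [h]
  -- Unbalanced gates contribute the empty set, so the bound `hA` holds for all gates.
  let A : Fin D.size → Set (Fin n → ZMod 2) := fun i =>
    if n ≤ 3 * (D.vars i).ncard ∧ 3 * (D.vars i).ncard ≤ 2 * n then D.acceptedThrough i else ∅
  have hA : ∀ i, (A i).ncard * 2 ^ (2 * s) ≤ 2 ^ n := by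
    intro i
    by_cases h : n ≤ 3 * (D.vars i).ncard ∧ 3 * (D.vars i).ncard ≤ 2 * n
    · simp only [A, if_pos h]
      rw [Set.ncard_eq_toFinset_card'] at h
      refine hH.ncard_mul_le_of_mix h.1 h.2 (fun a ha => (hout a).1 (ha.1.eval_output ha.2)) ?_
      intro a ha b hb c hac hbc
      simp only [Set.mem_toFinset] at hac hbc
      exact NNF.mem_acceptedThrough_of_mix hD ha hb hac hbc
    · simp [A, h]
  have hcover : (codeOfCheckMatrix H : Set (Fin n → ZMod 2)) ⊆ ⋃ i, A i := by
    intro a ha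
    have ha' : H.mulVec a = 0 := ha
    obtain ⟨i, hi, h1, h2⟩ := NNF.exists_balanced_gate hD (a := a) (by simpa using hn)
      ((hout a).2 ha') (fun T hT => by
        simpa using hH.ncard_lt_of_free hs fun b hb => (hout b).1 (hT b hb))
    rw [Fintype.card_fin] at h1 h2
    refine Set.mem_iUnion.2 ⟨i, ?_⟩
    simpa only [A, if_pos (And.intro h1 h2)] using hi
  have hC : 2 ^ n ≤ Nat.card (codeOfCheckMatrix H) * 2 ^ m := by
    have h := natCard_ker_mulVecLin H
    rw [Fintype.card_fin] at h
    rw [← h]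
    exact Nat.mul_le_mul_left _ (Nat.pow_le_pow_right (by norm_num) (by
      simpa using H.rank_le_card_height))
  have hsum : Nat.card (codeOfCheckMatrix H) * 2 ^ (2 * s) ≤ D.size * 2 ^ n := by
    calc Nat.card (codeOfCheckMatrix H) * 2 ^ (2 * s)
        ≤ (∑ i, (A i).ncard) * 2 ^ (2 * s) := by
          refine Nat.mul_le_mul_right _ ?_
          refine (Set.ncard_le_ncard hcover (Set.toFinite _)).trans ?_
          simpa using Set.ncard_iUnion_le_of_fintype A
      _ = ∑ i, (A i).ncard * 2 ^ (2 * s) := Finset.sum_mul _ _ _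
      _ ≤ ∑ _i : Fin D.size, 2 ^ n := Finset.sum_le_sum fun i _ => hA i
      _ = D.size * 2 ^ n := by simp
  refine Nat.le_of_mul_le_mul_left ?_ (Nat.two_pow_pos n)
  calc 2 ^ n * 2 ^ (2 * s) ≤ Nat.card (codeOfCheckMatrix H) * 2 ^ m * 2 ^ (2 * s) :=
        Nat.mul_le_mul_right _ hC
    _ = Nat.card (codeOfCheckMatrix H) * 2 ^ (2 * s) * 2 ^ m := by ring
    _ ≤ D.size * 2 ^ n * 2 ^ m := Nat.mul_le_mul_right _ hsum
    _ = 2 ^ n * (D.size * 2 ^ m) := by ring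

end IsGoodMatrix

/-! ### Existence of good matrices -/

/-- Independent linear forms `y`, `z` on `𝔽₂ᵐ` have a quarter of all vectors as common zeros. -/
theorem card_common_zeros {m : ℕ} {y z : Fin m → ZMod 2}
    (h : LinearIndependent (ZMod 2) ![y, z]) :
    4 * ({v : Fin m → ZMod 2 | y ⬝ᵥ v = 0 ∧ z ⬝ᵥ v = 0} : Finset _).card = 2 ^ m := by
  have h1 := natCard_ker_mulVecLin (Matrix.of ![y, z])
  have h2 : (Matrix.of ![y, z]).rank = 2 := by
    simpa using LinearIndependent.rank_matrix (M := Matrix.of ![y, z]) h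
  rw [h2, Fintype.card_fin] at h1
  have h3 : (({v : Fin m → ZMod 2 | y ⬝ᵥ v = 0 ∧ z ⬝ᵥ v = 0} : Finset _) :
      Set (Fin m → ZMod 2)) = LinearMap.ker (Matrix.of ![y, z]).mulVecLin := by
    ext v
    simp [funext_iff, Fin.forall_fin_two]
  rw [← h1, mul_comm, ← Set.ncard_coe_finset, h3, ← Nat.card_coe_set_eq]
  rfl

theorem sum_weight_common_zeros {m : ℕ} {y z : Fin m → ZMod 2}
    (h : LinearIndependent (ZMod 2) ![y, z]) :
    ∑ v : Fin m → ZMod 2, (if y ⬝ᵥ v = 0 ∧ z ⬝ᵥ v = 0 then (3 / 2 : ℝ) else 1)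
      = 9 / 8 * 2 ^ m := by
  have h1 : (4 : ℝ) * ({v : Fin m → ZMod 2 | y ⬝ᵥ v = 0 ∧ z ⬝ᵥ v = 0} : Finset _).card
      = 2 ^ m := by exact_mod_cast card_common_zeros h
  have h2 : ∀ v : Fin m → ZMod 2, (if y ⬝ᵥ v = 0 ∧ z ⬝ᵥ v = 0 then (3 / 2 : ℝ) else 1)
      = 1 + 1 / 2 * (if y ⬝ᵥ v = 0 ∧ z ⬝ᵥ v = 0 then 1 else 0) := by
    intro v
    split_ifs <;> norm_num
  simp_rw [h2]
  rw [Finset.sum_add_distrib, ← Finset.mul_sum, Finset.sum_boole]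
  simp only [Finset.sum_const, Finset.card_univ, Fintype.card_pi, ZMod.card, Finset.prod_const,
    Fintype.card_fin, nsmul_eq_mul, mul_one, Nat.cast_pow, Nat.cast_ofNat]
  linarith

/-- A family of `n` vectors of `𝔽₂ᵐ`, `m ≤ n / 100`, fewer than a third of which lie on any
subspace of codimension two. -/
theorem exists_few_common_zeros {m n : ℕ} (hmn : 100 * m ≤ n) (hm : 0 < m) :
    ∃ h : Fin n → Fin m → ZMod 2, ∀ y z : Fin m → ZMod 2, LinearIndependent (ZMod 2) ![y, z] →
      3 * ({j | y ⬝ᵥ h j = 0 ∧ z ⬝ᵥ h j = 0} : Finset (Fin n)).card < n := by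
  classical
  let P : Finset ((Fin m → ZMod 2) × (Fin m → ZMod 2)) :=
    {p | LinearIndependent (ZMod 2) ![p.1, p.2]}
  let N : (Fin n → Fin m → ZMod 2) → (Fin m → ZMod 2) × (Fin m → ZMod 2) → ℕ := fun h p =>
    ({j | p.1 ⬝ᵥ h j = 0 ∧ p.2 ⬝ᵥ h j = 0} : Finset (Fin n)).card
  have hP : (P.card : ℝ) ≤ 4 ^ m := by
    have : P.card ≤ 4 ^ m := by
      refine (Finset.card_le_univ P).trans ?_
      simp [← mul_pow]
    exact_mod_cast this
  -- Weight 3/2 per common zero has mean 3/4 + 1/4 · 3/2 = 9/8 per column, and columns are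
  -- independent.
  have hsum : ∑ h, ∑ p ∈ P, (3 / 2 : ℝ) ^ N h p ≤ ∑ _h : Fin n → Fin m → ZMod 2,
      (4 : ℝ) ^ m * (9 / 8) ^ n := by
    rw [Finset.sum_comm]
    have : ∀ p ∈ P, ∑ h, (3 / 2 : ℝ) ^ N h p = (9 / 8 * 2 ^ m) ^ n := by
      intro p hp
      rw [← sum_weight_common_zeros (Finset.mem_filter.1 hp).2, Fintype.sum_pow]
      refine Finset.sum_congr rfl fun h _ => ?_
      rw [Finset.prod_ite, Finset.prod_const, Finset.prod_const_one, mul_one]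
    rw [Finset.sum_congr rfl this, Finset.sum_const, Finset.sum_const, nsmul_eq_mul,
      nsmul_eq_mul]
    simp only [Finset.card_univ, Fintype.card_pi, ZMod.card, Finset.prod_const,
      Fintype.card_fin, Nat.cast_pow, Nat.cast_ofNat]
    rw [mul_pow]
    calc (P.card : ℝ) * ((9 / 8) ^ n * (2 ^ m) ^ n) ≤ 4 ^ m * ((9 / 8) ^ n * (2 ^ m) ^ n) := by
          gcongr
      _ = (2 ^ m) ^ n * (4 ^ m * (9 / 8) ^ n) := by ring
  obtain ⟨h, -, hh⟩ := Finset.exists_le_of_sum_le Finset.univ_nonempty hsum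
  refine ⟨h, fun y z hyz => ?_⟩
  by_contra! hN
  have h1 : (3 / 2 : ℝ) ^ N h (y, z) ≤ 4 ^ m * (9 / 8) ^ n := by
    refine le_trans ?_ hh
    exact Finset.single_le_sum (f := fun p => (3 / 2 : ℝ) ^ N h p)
      (fun p _ => by positivity) (Finset.mem_filter.2 ⟨Finset.mem_univ _, hyz⟩)
  -- Cubing clears the n/3 in the exponent; the contradiction is (256/243)^100 > 64.
  have h2 : (3 / 2 : ℝ) ^ n ≤ 64 ^ m * (729 / 512) ^ n := by
    calc (3 / 2 : ℝ) ^ n ≤ (3 / 2) ^ (3 * N h (y, z)) := pow_le_pow_right₀ (by norm_num) hN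
      _ = ((3 / 2) ^ N h (y, z)) ^ 3 := by rw [mul_comm, pow_mul]
      _ ≤ (4 ^ m * (9 / 8) ^ n) ^ 3 := by gcongr
      _ = (4 ^ 3) ^ m * ((9 / 8) ^ 3) ^ n := by rw [mul_pow, pow_right_comm, pow_right_comm _ n]
      _ = 64 ^ m * (729 / 512) ^ n := by norm_num
  have h3 : (256 / 243 : ℝ) ^ n ≤ 64 ^ m := by
    have : (3 / 2 : ℝ) ^ n = (256 / 243) ^ n * (729 / 512) ^ n := by
      rw [← mul_pow]; norm_num
    rw [this] at h2
    exact le_of_mul_le_mul_right h2 (by positivity)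
  have h4 : (64 : ℝ) ^ m < ((256 / 243) ^ 100) ^ m :=
    pow_lt_pow_left₀ (by norm_num) (by norm_num) hm.ne'
  rw [← pow_mul] at h4
  have h5 : (256 / 243 : ℝ) ^ (100 * m) ≤ (256 / 243) ^ n :=
    pow_le_pow_right₀ (by norm_num) hmn
  linarith

/-- Rank at most m-2 leaves two independent vectors in the left kernel, and every column in `I` is a
common zero of both. -/
theorem exists_isGoodMatrix {m n : ℕ} (hmn : 100 * m ≤ n) (hm : 0 < m) :
    ∃ H : Matrix (Fin m) (Fin n) (ZMod 2), IsGoodMatrix H ((m : ℤ) - 1) := by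
  obtain ⟨h, hh⟩ := exists_few_common_zeros hmn hm
  refine ⟨fun i j => h j i, fun I hI => ?_⟩
  by_contra! hr
  set M : Matrix (Fin m) I (ZMod 2) :=
    Matrix.submatrix (fun i j => h j i) id (fun j : I => (j : Fin n))
  have hfin := LinearMap.finrank_range_add_finrank_ker M.transpose.mulVecLin
  rw [Module.finrank_fintype_fun_eq_card, Fintype.card_fin] at hfin
  change M.transpose.rank + _ = m at hfin
  rw [Matrix.rank_transpose] at hfin
  have hlt : 1 < Module.finrank (ZMod 2) (LinearMap.ker M.transpose.mulVecLin) := by omega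
  have := Module.nontrivial_of_finrank_pos (zero_lt_one.trans hlt)
  obtain ⟨y, hy⟩ := exists_ne (0 : LinearMap.ker M.transpose.mulVecLin)
  obtain ⟨z, hyz⟩ := exists_linearIndependent_pair_of_one_lt_finrank hlt hy
  have hind : LinearIndependent (ZMod 2) ![(y : Fin m → ZMod 2), z] := by
    have : ![(y : Fin m → ZMod 2), z] = Submodule.subtype _ ∘ ![y, z] := by
      ext i
      fin_cases i <;> rfl
    rw [this]
    exact hyz.map' (Submodule.subtype _) (Submodule.ker_subtype _)
  have hker : ∀ w : LinearMap.ker M.transpose.mulVecLin, ∀ j ∈ I,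
      (w : Fin m → ZMod 2) ⬝ᵥ h j = 0 := by
    intro w j hj
    have hw : M.transpose.mulVec w = 0 := w.2
    rw [dotProduct_comm]
    exact congrFun hw ⟨j, hj⟩
  have hcard := hh y z hind
  have hsub : I ⊆ ({j | (y : Fin m → ZMod 2) ⬝ᵥ h j = 0 ∧ (z : Fin m → ZMod 2) ⬝ᵥ h j = 0} :
      Finset (Fin n)) := fun j hj =>
    Finset.mem_filter.2 ⟨Finset.mem_univ _, hker y j hj, hker z j hj⟩
  have hI' : n ≤ 3 * I.card := by
    have : (n : ℝ) ≤ 3 * I.card := by linarith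
    exact_mod_cast this
  have := Finset.card_le_card hsub
  omega

/-! ### Choice of constants -/

theorem theorem3 :
    ∃ (c : ℝ) (n₀ : ℕ), 0 < c ∧
      ∀ n : ℕ, n₀ ≤ n →
        (goodCodes n).Nonempty ∧
        ∀ C ∈ goodCodes n, ∀ D : NNF (Fin n),
          D.IsDDNNF → D.Encodes (charFun_linearCode C) →
            (2 : ℝ) ^ (c * (n : ℝ)) ≤ (D.size : ℝ) := by
  refine ⟨1 / 200, 600, by norm_num, fun n hn => ⟨?_, ?_⟩⟩
  · obtain ⟨H, hH⟩ := exists_isGoodMatrix (m := n / 100) (n := n) (by omega) (by omega)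
    exact ⟨_, H, hH, rfl⟩
  · rintro _ ⟨H, hH, rfl⟩ D hD hDH
    have hs : ((n / 100 : ℕ) : ℤ) - 1 = ((n / 100 - 1 : ℕ) : ℤ) := by omega
    rw [hs] at hH
    have h1 := hH.two_pow_le_size (by omega) (by omega) hD.1 hDH
    have h2 : 2 ^ (n / 100 - 2) ≤ D.size := by
      refine Nat.le_of_mul_le_mul_right ?_ (Nat.two_pow_pos (n / 100))
      rw [← pow_add]
      convert h1 using 2
      omega
    -- `n ≥ 600` absorbs both the floor and the loss of 2 in the exponent.
    have h3 : (n : ℝ) ≤ 200 * ((n / 100 - 2 : ℕ) : ℝ) := by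
      have : n ≤ 200 * (n / 100 - 2) := by omega
      exact_mod_cast this
    calc (2 : ℝ) ^ (1 / 200 * (n : ℝ)) ≤ (2 : ℝ) ^ ((n / 100 - 2 : ℕ) : ℝ) :=
          Real.rpow_le_rpow_of_exponent_le (by norm_num) (by linarith)
      _ = 2 ^ (n / 100 - 2) := Real.rpow_natCast _ _
      _ ≤ D.size := by exact_mod_cast h2
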